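/- By a manifold we mean a second-countable Hausdorff smooth manifold of some finite dimension, without boundary. Let $K$ be a compact manifold and $M$ a manifold, and let $C^\infty(K,M)$ be the set of smooth maps $K\to M$, equipped with the functional diffeology: a map $P:\mathbb{R}^n\to C^\infty(K,M)$ is a plot if and only if $(u,x)\mapsto P(u)(x)$ is a smooth map $\mathbb{R}^n\times K\to M$. A subset $A\subseteq C^\infty(K,M)$ is called D-open if $P^{-1}(A)$ is open in $\mathbb{R}^n$ for every $n$ and every plot $P:\mathbb{R}^n\to C^\infty(K,M)$. Then each of the following subsets of $C^\infty(K,M)$ is D-open: (i) the diffeomorphisms $K\to M$; (ii) the étale maps, i.e. the local diffeomorphisms $K\to M$; (iii) the submersions $K\to M$; (iv) the immersions $K\to M$; (v) the (smooth) embeddings $K\to M$, i.e. the immersions that are homeomorphisms onto their image; (vi) for every embedded submanifold $N\subseteq M$ (of any dimension) that is a closed subset of $M$, the maps $f$ transversal to $N$, i.e. those with $df_x(T_xK)+T_{f(x)}N=T_{f(x)}M$ for all $x\in K$ with $f(x)\in N$. -/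

import Mathlib

open scoped Manifold ContDiff Topology
open Diffeology

noncomputable section

/-- The standard diffeology of a smooth `m`-manifold `M`: the plots are the maps `ℝⁿ → M` that are
smooth in the usual sense. -/
@[reducible]
def manifoldDiffeology (m : ℕ) (M : Type*) [TopologicalSpace M]
    [ChartedSpace (EuclideanSpace ℝ (Fin m)) M] : DiffeologicalSpace M :=
  DiffeologicalSpace.ofCorePlotsOn
    { isPlotOn := fun {n u} _ p ↦ ContMDiffOn (𝓡 n) (𝓡 m) ∞ p u
      isPlotOn_congr := fun _ _ _ h ↦ contMDiffOn_congr h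
      isPlot := fun {n} p ↦ ContMDiff (𝓡 n) (𝓡 m) ∞ p
      isPlotOn_univ := contMDiffOn_univ
      isPlot_const := fun _ ↦ contMDiff_const
      isPlotOn_reparam := fun _ _ _ h hp hf ↦ hp.comp hf.contMDiffOn h.subset_preimage
      locality := fun _ _ h x hx ↦ by
        obtain ⟨v, hv, hxv, hv'⟩ := h x hx
        exact ((hv' x hxv).contMDiffAt (hv.mem_nhds hxv)).contMDiffWithinAt }

/-- The product diffeology on `X × Y`: a map is a plot iff both of its components are plots. -/
@[reducible]
def prodDiffeology (X Y : Type*) [DiffeologicalSpace X] [DiffeologicalSpace Y] :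
    DiffeologicalSpace (X × Y) where
  plots _ := {p | IsPlot (fun u ↦ (p u).1) ∧ IsPlot (fun u ↦ (p u).2)}
  constant_plots _ := ⟨isPlot_const, isPlot_const⟩
  plot_reparam hp hf := ⟨isPlot_reparam hp.1 hf, isPlot_reparam hp.2 hf⟩
  locality hp :=
    ⟨DiffeologicalSpace.locality fun x ↦ by
        obtain ⟨u, hu, hxu, h⟩ := hp x
        exact ⟨u, hu, hxu, fun hfu hf ↦ (h hfu hf).1⟩,
      DiffeologicalSpace.locality fun x ↦ by
        obtain ⟨u, hu, hxu, h⟩ := hp x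
        exact ⟨u, hu, hxu, fun hfu hf ↦ (h hfu hf).2⟩⟩

/-- The functional diffeology on a space `F` of smooth maps between diffeological spaces
`X` and `Y`: a map `p : ℝⁿ → F` is a plot iff `(u, x) ↦ p u x` is a smooth map `ℝⁿ × X → Y`,
where `ℝⁿ × X` carries the product diffeology. -/
@[reducible]
def functionalDiffeology (F X Y : Type*) [DiffeologicalSpace X] [DiffeologicalSpace Y]
    [FunLike F X Y] (hF : ∀ f : F, DSmooth (f : X → Y)) : DiffeologicalSpace F where
  plots n := {p | @DSmooth (EuclideanSpace ℝ (Fin n) × X) Y (prodDiffeology _ _) _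
    (fun z ↦ p z.1 z.2)}
  constant_plots f := fun l q hq ↦ hF f l _ hq.2
  plot_reparam {n m p f} hp hf := fun l q hq ↦
    hp l (fun v ↦ (f (q v).1, (q v).2))
      ⟨(hf.comp (IsPlot.contDiff hq.1)).isPlot, hq.2⟩
  locality {n p} hp := fun l q hq ↦ by
    refine DiffeologicalSpace.locality fun v ↦ ?_
    obtain ⟨u, hu, hvu, h⟩ := hp (q v).1
    refine ⟨(fun w ↦ (q w).1) ⁻¹' u, hu.preimage (IsPlot.contDiff hq.1).continuous, hvu,
      fun {k f} hfu hf ↦ ?_⟩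
    exact h (f := fun w ↦ (q (f w)).1) hfu ((IsPlot.contDiff hq.1).comp hf) k
      (fun w ↦ (w, (q (f w)).2)) ⟨isPlot_id, isPlot_reparam hq.2 hf⟩

/-- The functional diffeology on the set `C^∞(K, M)` of smooth maps between manifolds. -/
@[reducible]
def smoothMapsDiffeology (k m : ℕ) (K M : Type*)
    [TopologicalSpace K] [ChartedSpace (EuclideanSpace ℝ (Fin k)) K]
    [TopologicalSpace M] [ChartedSpace (EuclideanSpace ℝ (Fin m)) M] :
    DiffeologicalSpace C^∞⟮𝓡 k, K; 𝓡 m, M⟯ :=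
  letI := manifoldDiffeology k K
  letI := manifoldDiffeology m M
  functionalDiffeology C^∞⟮𝓡 k, K; 𝓡 m, M⟯ K M fun f _ _ hp ↦ f.contMDiff.comp hp

/-- A set of smooth maps `K → M` is D-open if it is open in the D-topology of the functional
diffeology, i.e. if its preimage under every plot is open. -/
def IsDOpen {k m : ℕ} {K M : Type*}
    [TopologicalSpace K] [ChartedSpace (EuclideanSpace ℝ (Fin k)) K]
    [TopologicalSpace M] [ChartedSpace (EuclideanSpace ℝ (Fin m)) M]
    (A : Set C^∞⟮𝓡 k, K; 𝓡 m, M⟯) : Prop :=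
  IsOpen[(smoothMapsDiffeology k m K M).dTopology] A

/-- `N`, a subset of `M` with a `d`-dimensional manifold structure on its subspace topology, is a
closed (embedded) submanifold: the inclusion is a smooth embedding and `N` is a closed subset. -/
structure IsClosedSubmanifold (d m : ℕ) {M : Type*}
    [TopologicalSpace M] [ChartedSpace (EuclideanSpace ℝ (Fin m)) M]
    (N : Set M) [ChartedSpace (EuclideanSpace ℝ (Fin d)) N] : Prop where
  isManifold : IsManifold (𝓡 d) ∞ N
  isSmoothEmbedding : Manifold.IsSmoothEmbedding (𝓡 d) (𝓡 m) ∞ (Subtype.val : N → M)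
  isClosed : IsClosed N

/-- `f` is transversal to the submanifold `N`: whenever `f x ∈ N`,
`df_x (T_x K) + T_{f x} N = T_{f x} M`. -/
def IsTransversalTo {k m : ℕ} (d : ℕ) {K M : Type*}
    [TopologicalSpace K] [ChartedSpace (EuclideanSpace ℝ (Fin k)) K]
    [TopologicalSpace M] [ChartedSpace (EuclideanSpace ℝ (Fin m)) M]
    (f : C^∞⟮𝓡 k, K; 𝓡 m, M⟯) (N : Set M) [ChartedSpace (EuclideanSpace ℝ (Fin d)) N] : Prop :=
  ∀ (x : K) (hx : f x ∈ N),
    LinearMap.range (mfderiv (𝓡 k) (𝓡 m) f x : TangentSpace (𝓡 k) x →ₗ[ℝ] TangentSpace (𝓡 m) (f x))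
      ⊔ LinearMap.range (mfderiv (𝓡 d) (𝓡 m) (Subtype.val : N → M) ⟨f x, hx⟩ :
          TangentSpace (𝓡 d) (⟨f x, hx⟩ : N) →ₗ[ℝ] TangentSpace (𝓡 m) (f x)) = ⊤

end

/-! Membership is tested along a smooth family `(u, x) ↦ P u x` near a parameter `u₀`. Immersions,
submersions and étale maps are cut out by a condition on `df_x` at every `x`: injective, surjective,
bijective. In charts the derivative of `P u` at `x` is continuous in `(u, x)` jointly, and
injectivity and surjectivity are open conditions on linear maps in finite dimension. So the
condition persists near each `(u₀, x)`, and compactness of `K` yields one neighbourhood of `u₀` that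
serves all `x` (`isDOpen_of_forall_eventually`). Transversality is of the same kind: in a slice
chart the tangent spaces of `N` are the kernels of the differential of a projection `g`, so the
condition becomes surjectivity of `d(g ∘ f)`; off the closed set `N` it is vacuous nearby.

Embeddings of a compact `K` are the injective immersions. Injectivity is a condition on pairs in the
compact space `K × K`: off the diagonal it persists because `M` is Hausdorff, on the diagonal by an
inverse function theorem with parameters (`ContMDiff.eventually_injective_of_injective_mfderiv`).
Diffeomorphisms are the bijective étale maps; surjectivity persists because the image is clopen and
the parameter space is connected.

Two bridges are needed. Plots of the functional diffeology, tested on Euclidean plots only, are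
jointly smooth on `ℝⁿ × K` (`contMDiff_uncurry_of_isPlot`); and immersions and submersions, defined
by normal forms in charts, are characterized by their derivatives through the inverse function
theorem. -/

section LinearAlgebra

/-! ### Linear algebra: open conditions and complements -/

variable {E E' F : Type*} [NormedAddCommGroup E] [NormedSpace ℝ E]
  [NormedAddCommGroup E'] [NormedSpace ℝ E'] [NormedAddCommGroup F] [NormedSpace ℝ F]

/-- A bijective continuous linear map on a finite-dimensional space is a continuous linear
equivalence. -/
theorem ContinuousLinearMap.exists_equiv_of_bijective [FiniteDimensional ℝ E] (A : E →L[ℝ] E')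
    (hA : Function.Bijective A) : ∃ e : E ≃L[ℝ] E', (e : E →L[ℝ] E') = A := by
  let l : E ≃ₗ[ℝ] E' := LinearEquiv.ofBijective A.toLinearMap hA
  have : FiniteDimensional ℝ E' := l.finiteDimensional
  exact ⟨l.toContinuousLinearEquiv, by ext x; rfl⟩

theorem ContinuousLinearMap.exists_leftInverse_of_injective [FiniteDimensional ℝ E']
    (A : E →L[ℝ] E') (hA : Function.Injective A) :
    ∃ B : E' →L[ℝ] E, ∀ x, B (A x) = x := by
  obtain ⟨g, hg⟩ := LinearMap.exists_leftInverse_of_injective A.toLinearMap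
    (LinearMap.ker_eq_bot.2 hA)
  exact ⟨LinearMap.toContinuousLinearMap g, fun x ↦ LinearMap.congr_fun hg x⟩

theorem ContinuousLinearMap.exists_rightInverse_of_surjective' [FiniteDimensional ℝ E']
    (A : E →L[ℝ] E') (hA : Function.Surjective A) :
    ∃ B : E' →L[ℝ] E, ∀ x, A (B x) = x := by
  obtain ⟨g, hg⟩ := LinearMap.exists_rightInverse_of_surjective A.toLinearMap
    (LinearMap.range_eq_top.2 hA)
  exact ⟨LinearMap.toContinuousLinearMap g, fun x ↦ LinearMap.congr_fun hg x⟩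

/-- Surjectivity is an open condition on continuous linear maps with finite-dimensional target. -/
theorem ContinuousLinearMap.isOpen_surjective [FiniteDimensional ℝ E'] :
    IsOpen {A : E →L[ℝ] E' | Function.Surjective A} := by
  rw [isOpen_iff_mem_nhds]
  intro A hA
  obtain ⟨B, hB⟩ := A.exists_rightInverse_of_surjective' hA
  have hc : Continuous fun A' : E →L[ℝ] E' ↦ A'.comp B := by fun_prop
  have h1 : A.comp B = (ContinuousLinearEquiv.refl ℝ E' : E' →L[ℝ] E') := by
    ext x; simp [hB]
  -- For `A'` near `A`, the endomorphism `A' ∘ B` is near the identity, hence invertible, so `A'` is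
  -- onto.
  have := hc.continuousAt (x := A) (by
    rw [h1]; exact (ContinuousLinearEquiv.refl ℝ E').nhds)
  filter_upwards [this] with A' hA'
  obtain ⟨e, he⟩ := hA'
  intro y
  refine ⟨B (e.symm y), ?_⟩
  have := congrArg (fun L : E' →L[ℝ] E' ↦ L (e.symm y)) he
  simpa using this.symm

/-- An injective linear map between finite-dimensional spaces extends to an isomorphism from the
product with any space of complementary dimension. -/
theorem ContinuousLinearMap.exists_bijective_coprod_of_injective [FiniteDimensional ℝ E]
    [FiniteDimensional ℝ E'] [FiniteDimensional ℝ F] (A : E →L[ℝ] E')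
    (hA : Function.Injective A)
    (hF : Module.finrank ℝ E + Module.finrank ℝ F = Module.finrank ℝ E') :
    ∃ B : F →L[ℝ] E', Function.Bijective (A.coprod B) := by
  obtain ⟨C, hC⟩ := Submodule.exists_isCompl (LinearMap.range A.toLinearMap)
  have h1 := Submodule.finrank_add_eq_of_isCompl hC
  have h2 := LinearMap.finrank_range_of_inj (f := A.toLinearMap) hA
  let l : F ≃ₗ[ℝ] C := LinearEquiv.ofFinrankEq _ _ (by omega)
  refine ⟨LinearMap.toContinuousLinearMap (C.subtype ∘ₗ l.toLinearMap), ?_⟩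
  have hinj : Function.Injective
      (A.coprod (LinearMap.toContinuousLinearMap (C.subtype ∘ₗ l.toLinearMap))) := by
    rw [injective_iff_map_eq_zero]
    rintro ⟨x, y⟩ h
    have h : A x + (l y : E') = 0 := h
    have h3 : (l y : E') ∈ LinearMap.range A.toLinearMap :=
      ⟨-x, by
        have : (l y : E') = - A x := by rw [eq_neg_iff_add_eq_zero, add_comm]; exact h
        simp [this]⟩
    have h4 : (l y : E') = 0 := by
      have := hC.disjoint.le_bot ⟨h3, (l y).2⟩
      simpa using this
    have h5 : y = 0 := by simpa using h4
    have h6 : x = 0 := hA (by simpa [h4] using h)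
    simp [h5, h6]
  refine ⟨hinj, ?_⟩
  have := (LinearMap.injective_iff_surjective_of_finrank_eq_finrank
    (f := (A.coprod (LinearMap.toContinuousLinearMap (C.subtype ∘ₗ l.toLinearMap))).toLinearMap)
    (by simp [Module.finrank_prod, hF])).1 hinj
  exact this

/-- A surjective linear map between finite-dimensional spaces extends to an isomorphism onto the
product with any space of complementary dimension. -/
theorem ContinuousLinearMap.exists_bijective_prod_of_surjective [FiniteDimensional ℝ E]
    [FiniteDimensional ℝ E'] [FiniteDimensional ℝ F] (A : E →L[ℝ] E')
    (hA : Function.Surjective A)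
    (hF : Module.finrank ℝ E = Module.finrank ℝ E' + Module.finrank ℝ F) :
    ∃ B : E →L[ℝ] F, Function.Bijective (A.prod B) := by
  obtain ⟨C, hC⟩ := Submodule.exists_isCompl (LinearMap.ker A.toLinearMap)
  have h1 := LinearMap.finrank_range_add_finrank_ker A.toLinearMap
  rw [LinearMap.range_eq_top.2 hA, finrank_top] at h1
  let l : LinearMap.ker A.toLinearMap ≃ₗ[ℝ] F := LinearEquiv.ofFinrankEq _ _ (by omega)
  let pr := Submodule.projectionOnto _ _ hC
  refine ⟨LinearMap.toContinuousLinearMap (l.toLinearMap ∘ₗ pr), ?_⟩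
  have hinj : Function.Injective
      (A.prod (LinearMap.toContinuousLinearMap (l.toLinearMap ∘ₗ pr))) := by
    rw [injective_iff_map_eq_zero]
    intro x h
    have ha : A x = 0 := congrArg Prod.fst h
    have hb : l (pr x) = 0 := congrArg Prod.snd h
    have hb' : pr x = 0 := by simpa using hb
    have : pr x = ⟨x, ha⟩ := Submodule.projectionOnto_apply_left hC ⟨x, ha⟩
    rw [this] at hb'
    exact congrArg Subtype.val hb'
  refine ⟨hinj, ?_⟩
  exact (LinearMap.injective_iff_surjective_of_finrank_eq_finrank
    (f := (A.prod (LinearMap.toContinuousLinearMap (l.toLinearMap ∘ₗ pr))).toLinearMap)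
    (by simp [Module.finrank_prod, hF])).1 hinj

end LinearAlgebra

/-! ### The inverse function theorem -/

section InverseFunction

variable {E E' : Type*} [NormedAddCommGroup E] [NormedSpace ℝ E]
  [NormedAddCommGroup E'] [NormedSpace ℝ E']

/-- **Inverse function theorem**: a smooth map with invertible derivative at a point is a local
diffeomorphism there. -/
theorem ContDiffOn.isLocalDiffeomorphAt [CompleteSpace E] {f : E → E'} {s : Set E} {a : E}
    (hs : IsOpen s) (ha : a ∈ s) (hf : ContDiffOn ℝ ∞ f s) {f' : E ≃L[ℝ] E'}
    (hf' : HasFDerivAt f (f' : E →L[ℝ] E') a) :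
    IsLocalDiffeomorphAt 𝓘(ℝ, E) 𝓘(ℝ, E') ∞ f a := by
  have hfa : ContDiffAt ℝ ∞ f a := hf.contDiffAt (hs.mem_nhds ha)
  let R := hfa.toOpenPartialHomeomorph f hf' (by simp)
  have hcont : ContinuousOn (fderiv ℝ f) s := hf.continuousOn_fderiv_of_isOpen hs (by simp)
  -- Restricting to the open set where the derivative is invertible makes the inverse smooth on its
  -- whole domain, not only at the image of `a`.
  let U := s ∩ fderiv ℝ f ⁻¹' Set.range ((↑) : (E ≃L[ℝ] E') → E →L[ℝ] E')
  have hU : IsOpen U := hcont.isOpen_inter_preimage hs ContinuousLinearEquiv.isOpen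
  let R' := R.restrOpen U hU
  have hsrc : R'.source = R.source ∩ U := R.restrOpen_source U hU
  have hcoe : ∀ x, R' x = f x := fun x ↦ rfl
  refine ⟨⟨R'.toPartialEquiv, R'.open_source, R'.open_target, ?_, ?_⟩, ?_, fun x _ ↦ rfl⟩
  · exact (hf.mono fun x hx ↦ (hsrc ▸ hx : x ∈ R.source ∩ U).2.1).contMDiffOn
  · refine ContDiffOn.contMDiffOn fun y hy ↦ ContDiffAt.contDiffWithinAt ?_
    have hy' : R'.symm y ∈ R.source ∩ U := hsrc ▸ R'.map_target hy
    obtain ⟨e, he⟩ := hy'.2.2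
    have hd : ContDiffAt ℝ ∞ f (R'.symm y) := hf.contDiffAt (hs.mem_nhds hy'.2.1)
    refine R'.contDiffAt_symm (f₀' := e) hy ?_ hd
    rw [he]
    exact (hd.differentiableAt (by simp)).hasFDerivAt
  · change a ∈ R'.source
    rw [hsrc]
    exact ⟨hfa.mem_toOpenPartialHomeomorph_source hf' (by simp), ha, f', hf'.fderiv.symm⟩

end InverseFunction

/-! ### Local diffeomorphisms, charts and derivatives -/

section Charts

variable {E E' : Type*} [NormedAddCommGroup E] [NormedSpace ℝ E]
  [NormedAddCommGroup E'] [NormedSpace ℝ E']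
  {M : Type*} [TopologicalSpace M] [ChartedSpace E M]
  {M' : Type*} [TopologicalSpace M'] [ChartedSpace E' M']

/-- A chart in the maximal atlas, as a partial diffeomorphism. -/
noncomputable def OpenPartialHomeomorph.toPartialDiffeomorph (φ : OpenPartialHomeomorph M E)
    (hφ : φ ∈ IsManifold.maximalAtlas 𝓘(ℝ, E) ∞ M) :
    PartialDiffeomorph 𝓘(ℝ, E) 𝓘(ℝ, E) M E ∞ where
  toPartialEquiv := φ.toPartialEquiv
  open_source := φ.open_source
  open_target := φ.open_target
  contMDiffOn_toFun := contMDiffOn_of_mem_maximalAtlas hφ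
  contMDiffOn_invFun := contMDiffOn_symm_of_mem_maximalAtlas hφ

theorem OpenPartialHomeomorph.isLocalDiffeomorphAt {φ : OpenPartialHomeomorph M E}
    (hφ : φ ∈ IsManifold.maximalAtlas 𝓘(ℝ, E) ∞ M) {x : M} (hx : x ∈ φ.source) :
    IsLocalDiffeomorphAt 𝓘(ℝ, E) 𝓘(ℝ, E) ∞ φ x :=
  ⟨φ.toPartialDiffeomorph hφ, hx, fun _ _ ↦ rfl⟩

theorem OpenPartialHomeomorph.isLocalDiffeomorphAt_symm {φ : OpenPartialHomeomorph M E}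
    (hφ : φ ∈ IsManifold.maximalAtlas 𝓘(ℝ, E) ∞ M) {x : E} (hx : x ∈ φ.target) :
    IsLocalDiffeomorphAt 𝓘(ℝ, E) 𝓘(ℝ, E) ∞ φ.symm x :=
  ⟨(φ.toPartialDiffeomorph hφ).symm, hx, fun _ _ ↦ rfl⟩

theorem IsLocalDiffeomorphAt.congr_of_eventuallyEq {f g : M → M'} {x : M}
    (hf : IsLocalDiffeomorphAt 𝓘(ℝ, E) 𝓘(ℝ, E') ∞ f x) (h : g =ᶠ[𝓝 x] f) :
    IsLocalDiffeomorphAt 𝓘(ℝ, E) 𝓘(ℝ, E') ∞ g x := by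
  obtain ⟨Φ, hx, hΦ⟩ := hf
  obtain ⟨s, hs, hso, hxs⟩ := mem_nhds_iff.1 h
  let R := Φ.toOpenPartialHomeomorph.restrOpen s hso
  have hsrc : R.source = Φ.source ∩ s := OpenPartialHomeomorph.restrOpen_source _ s hso
  refine ⟨⟨R.toPartialEquiv, R.open_source, R.open_target, ?_, ?_⟩, ?_, ?_⟩
  · exact Φ.contMDiffOn_toFun.mono fun y hy ↦ (hsrc ▸ hy : y ∈ Φ.source ∩ s).1
  · refine Φ.contMDiffOn_invFun.mono fun y hy ↦ ?_
    have hy' : y ∈ R.target := hy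
    have h2 : R.symm y ∈ Φ.source ∩ s := hsrc ▸ R.map_target hy'
    have h3 : R (R.symm y) = y := R.right_inv hy'
    rw [← h3]
    exact Φ.map_source h2.1
  · change x ∈ R.source
    rw [hsrc]
    exact ⟨hx, hxs⟩
  · intro y hy
    have hy' : y ∈ Φ.source ∩ s := hsrc ▸ hy
    exact (hs hy'.2).trans (hΦ hy'.1)

theorem IsLocalDiffeomorphAt.bijective_mfderiv {f : M → M'} {x : M}
    (hf : IsLocalDiffeomorphAt 𝓘(ℝ, E) 𝓘(ℝ, E') ∞ f x) :
    Function.Bijective (mfderiv 𝓘(ℝ, E) 𝓘(ℝ, E') f x) := by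
  rw [← hf.mfderivToContinuousLinearEquiv_coe (by simp)]
  exact (hf.mfderivToContinuousLinearEquiv (by simp)).bijective

theorem OpenPartialHomeomorph.bijective_mfderiv {φ : OpenPartialHomeomorph M E}
    (hφ : φ ∈ IsManifold.maximalAtlas 𝓘(ℝ, E) ∞ M) {x : M} (hx : x ∈ φ.source) :
    Function.Bijective (mfderiv 𝓘(ℝ, E) 𝓘(ℝ, E) φ x) :=
  (φ.isLocalDiffeomorphAt hφ hx).bijective_mfderiv

/-- The representative of a smooth map in the preferred charts at `x` and `f x`: it is smooth near
the image of `x` and its derivative there is `mfderiv f x`. -/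
theorem ContMDiff.exists_contDiffOn_chart [IsManifold 𝓘(ℝ, E) ∞ M] [IsManifold 𝓘(ℝ, E') ∞ M']
    {f : M → M'} (hf : ContMDiff 𝓘(ℝ, E) 𝓘(ℝ, E') ∞ f) (x : M) :
    ∃ s : Set E, IsOpen s ∧ chartAt E x x ∈ s ∧ s ⊆ (chartAt E x).target ∧
      (∀ e ∈ s, f ((chartAt E x).symm e) ∈ (chartAt E' (f x)).source) ∧
      ContDiffOn ℝ ∞ (chartAt E' (f x) ∘ f ∘ (chartAt E x).symm) s ∧
      HasFDerivAt (chartAt E' (f x) ∘ f ∘ (chartAt E x).symm)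
        (mfderiv 𝓘(ℝ, E) 𝓘(ℝ, E') f x : E →L[ℝ] E') (chartAt E x x) := by
  set φ := chartAt E x
  set ψ := chartAt E' (f x)
  have hφ : φ ∈ IsManifold.maximalAtlas 𝓘(ℝ, E) ∞ M := IsManifold.chart_mem_maximalAtlas x
  have hψ : ψ ∈ IsManifold.maximalAtlas 𝓘(ℝ, E') ∞ M' := IsManifold.chart_mem_maximalAtlas (f x)
  have hso : IsOpen (φ.target ∩ φ.symm ⁻¹' (f ⁻¹' ψ.source)) :=
    φ.isOpen_inter_preimage_symm (ψ.open_source.preimage hf.continuous)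
  have hx : φ x ∈ φ.target ∩ φ.symm ⁻¹' (f ⁻¹' ψ.source) :=
    ⟨mem_chart_target E x, by
      simp [φ, ψ, (chartAt E x).left_inv (mem_chart_source E x)]⟩
  refine ⟨φ.target ∩ φ.symm ⁻¹' (f ⁻¹' ψ.source), hso, hx, fun e he ↦ he.1, fun e he ↦ he.2,
    ?_, ?_⟩
  · rw [← contMDiffOn_iff_contDiffOn]
    refine (contMDiffOn_of_mem_maximalAtlas hψ).comp (t := ψ.source)
      (hf.comp_contMDiffOn ((contMDiffOn_symm_of_mem_maximalAtlas hφ).mono fun e he ↦ he.1)) ?_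
    exact fun e he ↦ he.2
  · have hd := (hf.mdifferentiableAt (x := x) (by simp)).hasMFDerivAt.2
    simp only [mfld_simps] at hd
    exact hasFDerivWithinAt_univ.1 hd

/-- Turns the straightening maps given by the inverse function theorem into charts of the maximal
atlas, as the normal forms require. -/
theorem IsLocalDiffeomorphAt.exists_chart [IsManifold 𝓘(ℝ, E) ∞ M] {g : M → E} {x : M}
    (h : IsLocalDiffeomorphAt 𝓘(ℝ, E) 𝓘(ℝ, E) ∞ g x) :
    ∃ φ ∈ IsManifold.maximalAtlas 𝓘(ℝ, E) ∞ M, x ∈ φ.source ∧ Set.EqOn g φ φ.source := by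
  obtain ⟨Φ, hx, hΦ⟩ := h
  exact ⟨Φ.toOpenPartialHomeomorph, OpenPartialHomeomorph.mem_maximalAtlas_of_contMDiffOn _
    Φ.contMDiffOn_toFun Φ.contMDiffOn_invFun, hx, hΦ⟩

theorem IsLocalDiffeomorphAt.exists_chart_symm [IsManifold 𝓘(ℝ, E) ∞ M] {g : E → M} {e : E}
    (h : IsLocalDiffeomorphAt 𝓘(ℝ, E) 𝓘(ℝ, E) ∞ g e) :
    ∃ φ ∈ IsManifold.maximalAtlas 𝓘(ℝ, E) ∞ M, e ∈ φ.target ∧ Set.EqOn g φ.symm φ.target := by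
  obtain ⟨Φ, hx, hΦ⟩ := h
  exact ⟨Φ.toOpenPartialHomeomorph.symm, OpenPartialHomeomorph.mem_maximalAtlas_of_contMDiffOn _
    Φ.contMDiffOn_invFun Φ.contMDiffOn_toFun, hx, hΦ⟩

/-- The derivative of a map that is linear in charts `φ`, `ψ`. -/
theorem mfderiv_comp_of_eqOn_charts {f : M → M'} {x : M}
    (hf : ContMDiff 𝓘(ℝ, E) 𝓘(ℝ, E') ∞ f)
    {φ : OpenPartialHomeomorph M E} {ψ : OpenPartialHomeomorph M' E'}
    (hφ : φ ∈ IsManifold.maximalAtlas 𝓘(ℝ, E) ∞ M)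
    (hψ : ψ ∈ IsManifold.maximalAtlas 𝓘(ℝ, E') ∞ M')
    (hx : x ∈ φ.source) (hfx : f x ∈ ψ.source) (L : E →L[ℝ] E')
    (h : Set.EqOn ((ψ.extend 𝓘(ℝ, E')) ∘ f ∘ (φ.extend 𝓘(ℝ, E)).symm) L
      (φ.extend 𝓘(ℝ, E)).target) (v : E) :
    mfderiv 𝓘(ℝ, E') 𝓘(ℝ, E') ψ (f x) (mfderiv 𝓘(ℝ, E) 𝓘(ℝ, E') f x v) =
      L (mfderiv 𝓘(ℝ, E) 𝓘(ℝ, E) φ x v) := by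
  have hdψ : MDifferentiableAt 𝓘(ℝ, E') 𝓘(ℝ, E') ψ (f x) :=
    (ψ.isLocalDiffeomorphAt hψ hfx).mdifferentiableAt (by simp)
  have hdφ : MDifferentiableAt 𝓘(ℝ, E) 𝓘(ℝ, E) φ x :=
    (φ.isLocalDiffeomorphAt hφ hx).mdifferentiableAt (by simp)
  have hdf : MDifferentiableAt 𝓘(ℝ, E) 𝓘(ℝ, E') f x := hf.mdifferentiableAt (by simp)
  have hdL : MDifferentiableAt 𝓘(ℝ, E) 𝓘(ℝ, E') L (φ x) :=
    L.differentiableAt.mdifferentiableAt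
  have heq : ψ ∘ f =ᶠ[𝓝 x] L ∘ φ := by
    filter_upwards [φ.open_source.mem_nhds hx] with y hy
    have := h (x := φ y) (by simpa [mfld_simps] using φ.map_source hy)
    simpa [mfld_simps, φ.left_inv hy] using this
  have h1 := heq.mfderiv_eq (I := 𝓘(ℝ, E)) (I' := 𝓘(ℝ, E'))
  rw [mfderiv_comp x hdψ hdf, mfderiv_comp x hdL hdφ, mfderiv_eq_fderiv, L.fderiv] at h1
  exact DFunLike.congr_fun h1 v

/-- In the charts of the normal form the map is `v ↦ equiv (v, 0)`, and charts have bijective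
derivatives. -/
theorem Manifold.IsImmersion.injective_mfderiv {f : M → M'}
    (h : Manifold.IsImmersion 𝓘(ℝ, E) 𝓘(ℝ, E') ∞ f) (x : M) :
    Function.Injective (mfderiv 𝓘(ℝ, E) 𝓘(ℝ, E') f x) := by
  have hf : ContMDiff 𝓘(ℝ, E) 𝓘(ℝ, E') ∞ f := h.contMDiff
  obtain ⟨F, _, _, hF⟩ := h
  have hF := hF x
  have key := mfderiv_comp_of_eqOn_charts hf hF.domChart_mem_maximalAtlas
    hF.codChart_mem_maximalAtlas hF.mem_domChart_source hF.mem_codChart_source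
    ((hF.equiv : E × F →L[ℝ] E').comp (ContinuousLinearMap.inl ℝ E F)) hF.writtenInCharts
  intro v w hvw
  have h1 := (key v).symm.trans ((congrArg _ hvw).trans (key w))
  have h2 := hF.equiv.injective h1
  exact (hF.domChart.bijective_mfderiv hF.domChart_mem_maximalAtlas
    hF.mem_domChart_source).1 (congrArg Prod.fst h2)

theorem Manifold.IsSubmersion.surjective_mfderiv {f : M → M'}
    (h : Manifold.IsSubmersion 𝓘(ℝ, E) 𝓘(ℝ, E') ∞ f) (x : M) :
    Function.Surjective (mfderiv 𝓘(ℝ, E) 𝓘(ℝ, E') f x) := by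
  have hf : ContMDiff 𝓘(ℝ, E) 𝓘(ℝ, E') ∞ f := h.contMDiff
  obtain ⟨F, _, _, hF⟩ := h
  have hF := hF x
  have key := mfderiv_comp_of_eqOn_charts hf hF.domChart_mem_maximalAtlas
    hF.codChart_mem_maximalAtlas hF.mem_domChart_source hF.mem_codChart_source
    ((ContinuousLinearMap.fst ℝ E' F).comp (hF.equiv : E →L[ℝ] E' × F)) hF.writtenInCharts
  intro w
  obtain ⟨v, hv⟩ := (hF.domChart.bijective_mfderiv hF.domChart_mem_maximalAtlas
    hF.mem_domChart_source).2
      (hF.equiv.symm (mfderiv 𝓘(ℝ, E') 𝓘(ℝ, E') hF.codChart (f x) w, 0))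
  refine ⟨v, (hF.codChart.bijective_mfderiv hF.codChart_mem_maximalAtlas
    hF.mem_codChart_source).1 ?_⟩
  rw [key v, hv]
  simp

end Charts

/-! ### Normal forms of smooth maps from their derivatives -/

section LocalForms

variable {E E' F : Type*} [NormedAddCommGroup E] [NormedSpace ℝ E] [FiniteDimensional ℝ E]
  [NormedAddCommGroup E'] [NormedSpace ℝ E']
  [NormedAddCommGroup F] [NormedSpace ℝ F]
  {M : Type*} [TopologicalSpace M] [ChartedSpace E M] [IsManifold 𝓘(ℝ, E) ∞ M]
  {M' : Type*} [TopologicalSpace M'] [ChartedSpace E' M'] [IsManifold 𝓘(ℝ, E') ∞ M']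
  {f : M → M'} {x : M}

/-- A smooth map is a local diffeomorphism wherever its derivative is bijective. -/
theorem ContMDiff.isLocalDiffeomorphAt (hf : ContMDiff 𝓘(ℝ, E) 𝓘(ℝ, E') ∞ f)
    (h : Function.Bijective (mfderiv 𝓘(ℝ, E) 𝓘(ℝ, E') f x)) :
    IsLocalDiffeomorphAt 𝓘(ℝ, E) 𝓘(ℝ, E') ∞ f x := by
  obtain ⟨s, hs, hxs, hst, hsf, hd, hd'⟩ := hf.exists_contDiffOn_chart x
  obtain ⟨e, he⟩ := ContinuousLinearMap.exists_equiv_of_bijective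
    (E := E) (E' := E') (mfderiv 𝓘(ℝ, E) 𝓘(ℝ, E') f x) h
  have hφ := IsManifold.chart_mem_maximalAtlas (I := 𝓘(ℝ, E)) (n := ∞) x
  have hψ := IsManifold.chart_mem_maximalAtlas (I := 𝓘(ℝ, E')) (n := ∞) (f x)
  rw [← he] at hd'
  have h1 := hd.isLocalDiffeomorphAt hs hxs hd'
  have h2 := ((chartAt E x).isLocalDiffeomorphAt hφ (mem_chart_source E x)).comp 𝓘(ℝ, E') _ h1
  have hfx : (chartAt E' (f x) ∘ f ∘ (chartAt E x).symm) (chartAt E x x)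
      = chartAt E' (f x) (f x) := by
    simp [(chartAt E x).left_inv (mem_chart_source E x)]
  have h3 := h2.comp 𝓘(ℝ, E') _ ((chartAt E' (f x)).isLocalDiffeomorphAt_symm hψ
    (x := ((chartAt E' (f x) ∘ f ∘ (chartAt E x).symm) ∘ chartAt E x) x) (by
      rw [Function.comp_apply, hfx]; exact mem_chart_target E' (f x)))
  refine h3.congr_of_eventuallyEq ?_
  have hc : ∀ᶠ y in 𝓝 x, y ∈ (chartAt E x).source :=
    (chartAt E x).open_source.mem_nhds (mem_chart_source E x)
  have hc' : ∀ᶠ y in 𝓝 x, f y ∈ (chartAt E' (f x)).source :=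
    hf.continuous.continuousAt ((chartAt E' (f x)).open_source.mem_nhds (mem_chart_source E' _))
  filter_upwards [hc, hc'] with y hy hy'
  simp [(chartAt E x).left_inv hy, (chartAt E' (f x)).left_inv hy']

/-- A smooth map with injective derivative at `x` is an immersion at `x`, with respect to any
complement of the right dimension. -/
theorem ContMDiff.isImmersionAtOfComplement [FiniteDimensional ℝ E'] [FiniteDimensional ℝ F]
    (hf : ContMDiff 𝓘(ℝ, E) 𝓘(ℝ, E') ∞ f)
    (h : Function.Injective (mfderiv 𝓘(ℝ, E) 𝓘(ℝ, E') f x))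
    (hF : Module.finrank ℝ E + Module.finrank ℝ F = Module.finrank ℝ E') :
    Manifold.IsImmersionAtOfComplement F 𝓘(ℝ, E) 𝓘(ℝ, E') ∞ f x := by
  obtain ⟨s, hs, hxs, hst, hsf, hd, hd'⟩ := hf.exists_contDiffOn_chart x
  set φ := chartAt E x
  set ψ := chartAt E' (f x)
  have hφ : φ ∈ IsManifold.maximalAtlas 𝓘(ℝ, E) ∞ M := IsManifold.chart_mem_maximalAtlas x
  have hψ : ψ ∈ IsManifold.maximalAtlas 𝓘(ℝ, E') ∞ M' := IsManifold.chart_mem_maximalAtlas (f x)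
  set A : E →L[ℝ] E' := mfderiv 𝓘(ℝ, E) 𝓘(ℝ, E') f x
  obtain ⟨B, hB⟩ := A.exists_bijective_coprod_of_injective (F := F) h hF
  obtain ⟨equiv, hequiv⟩ := ContinuousLinearMap.exists_equiv_of_bijective _ hB
  -- In the coordinates `E × F` this is `(e, w) ↦ f e + B w` (with `f` read in charts), whose
  -- derivative at `(φ x, 0)` is `A.coprod B = equiv`; hence `T` has derivative the identity at `a`.
  let T : E' → E' := fun z ↦ (ψ ∘ f ∘ φ.symm) (equiv.symm z).1 + B (equiv.symm z).2
  let a : E' := equiv (φ x, 0)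
  have hφx : φ.symm (φ x) = x := φ.left_inv (mem_chart_source E x)
  have hTa : T a = ψ (f x) := by simp [T, a, hφx]
  have ho : IsOpen ((fun z ↦ (equiv.symm z).1) ⁻¹' s) := hs.preimage (by fun_prop)
  have haS : a ∈ (fun z ↦ (equiv.symm z).1) ⁻¹' s := by simpa [a] using hxs
  have hT : ContDiffOn ℝ ∞ T ((fun z ↦ (equiv.symm z).1) ⁻¹' s) := by
    refine ContDiffOn.add (hd.comp (t := s) ?_ fun z hz ↦ hz) ?_
    · exact (contDiff_fst.comp equiv.symm.contDiff).contDiffOn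
    · exact (B.contDiff.comp (contDiff_snd.comp equiv.symm.contDiff)).contDiffOn
  have hT' : HasFDerivAt T ((ContinuousLinearEquiv.refl ℝ E' : E' ≃L[ℝ] E') : E' →L[ℝ] E') a := by
    have ha1 : (equiv.symm a).1 = φ x := by simp [a]
    have e1 : HasFDerivAt (fun z ↦ (equiv.symm z).1)
        ((ContinuousLinearMap.fst ℝ E F).comp (equiv.symm : E' →L[ℝ] E × F)) a :=
      ((ContinuousLinearMap.fst ℝ E F).comp (equiv.symm : E' →L[ℝ] E × F)).hasFDerivAt
    have e2 : HasFDerivAt (fun z ↦ B (equiv.symm z).2)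
        (B.comp ((ContinuousLinearMap.snd ℝ E F).comp (equiv.symm : E' →L[ℝ] E × F))) a :=
      (B.comp ((ContinuousLinearMap.snd ℝ E F).comp (equiv.symm : E' →L[ℝ] E × F))).hasFDerivAt
    have e3 := (HasFDerivAt.comp a (by rw [ha1]; exact hd') e1).add e2
    refine e3.congr_fderiv ?_
    ext z
    have : equiv (equiv.symm z) = (A.coprod B) (equiv.symm z) := by
      rw [← hequiv]; rfl
    rw [equiv.apply_symm_apply] at this
    simpa using this.symm
  have h1 := hT.isLocalDiffeomorphAt ho haS hT'
  have h2 := h1.comp 𝓘(ℝ, E') _ (ψ.isLocalDiffeomorphAt_symm hψ (x := T a)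
    (by rw [hTa]; exact mem_chart_target E' (f x)))
  -- Since `T (equiv (e, 0))` is `f` read in charts, the chart `χ` inverse to `ψ.symm ∘ T`
  -- straightens `f` to `e ↦ equiv (e, 0)`.
  obtain ⟨χ, hχ, haχ, hχT⟩ := h2.exists_chart_symm
  have hχa : χ.symm a = f x := by
    rw [← hχT haχ, Function.comp_apply, hTa]
    exact ψ.left_inv (mem_chart_source E' (f x))
  let U : Set M := φ.source ∩ φ ⁻¹' (s ∩ (fun e ↦ equiv (e, 0)) ⁻¹' χ.target)
  have hU : IsOpen U := φ.isOpen_inter_preimage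
    (hs.inter (χ.open_target.preimage (by fun_prop)))
  have hxU : x ∈ U := ⟨mem_chart_source E x, hxs, haχ⟩
  have hsrc : (φ.restr U).source = U := by
    rw [φ.restr_source, hU.interior_eq]
    exact Set.inter_eq_right.2 fun y hy ↦ hy.1
  refine Manifold.IsImmersionAtOfComplement.mk_of_continuousAt hf.continuous.continuousAt equiv
    (φ.restr U) χ (hsrc.symm ▸ hxU : x ∈ (φ.restr U).source) ?_ (restr_mem_maximalAtlas _ hφ hU) hχ ?_
  · rw [← hχa]; exact χ.map_target haχ
  · intro e he
    have he' : e ∈ (φ.restr U).target := by simpa [mfld_simps] using he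
    have h3 : (φ.restr U).symm e ∈ U := hsrc ▸ (φ.restr U).map_target he'
    have h4 : φ (φ.symm e) = e := (φ.restr U).right_inv he'
    have h3' : φ.symm e ∈ U := h3
    have h5 := h3'.2
    simp only [Set.mem_preimage, h4] at h5
    have h6 := hχT h5.2
    have h7 : f (φ.symm e) = χ.symm (equiv (e, 0)) := by
      rw [← h6]
      simp [T, ψ.left_inv (hsf e h5.1)]
    have h8 : χ (f (φ.symm e)) = equiv (e, 0) := by
      rw [h7, χ.right_inv h5.2]
    simpa [mfld_simps] using h8

/-- A smooth map with surjective derivative at `x` is a submersion at `x`, with respect to any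
complement of the right dimension. -/
theorem ContMDiff.isSubmersionAtOfComplement [FiniteDimensional ℝ E'] [FiniteDimensional ℝ F]
    (hf : ContMDiff 𝓘(ℝ, E) 𝓘(ℝ, E') ∞ f)
    (h : Function.Surjective (mfderiv 𝓘(ℝ, E) 𝓘(ℝ, E') f x))
    (hF : Module.finrank ℝ E = Module.finrank ℝ E' + Module.finrank ℝ F) :
    Manifold.IsSubmersionAtOfComplement F 𝓘(ℝ, E) 𝓘(ℝ, E') ∞ f x := by
  obtain ⟨s, hs, hxs, hst, hsf, hd, hd'⟩ := hf.exists_contDiffOn_chart x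
  set φ := chartAt E x
  set ψ := chartAt E' (f x)
  have hφ : φ ∈ IsManifold.maximalAtlas 𝓘(ℝ, E) ∞ M := IsManifold.chart_mem_maximalAtlas x
  have hψ : ψ ∈ IsManifold.maximalAtlas 𝓘(ℝ, E') ∞ M' := IsManifold.chart_mem_maximalAtlas (f x)
  set A : E →L[ℝ] E' := mfderiv 𝓘(ℝ, E) 𝓘(ℝ, E') f x
  obtain ⟨B, hB⟩ := A.exists_bijective_prod_of_surjective (F := F) h hF
  obtain ⟨equiv, hequiv⟩ := ContinuousLinearMap.exists_equiv_of_bijective _ hB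
  -- Only the source chart is changed: the first component of `equiv (T z)` is `f` read in charts,
  -- and `B` completes it to a map with derivative the identity at `φ x`.
  let T : E → E := fun z ↦ equiv.symm ((ψ ∘ f ∘ φ.symm) z, B z)
  have hT : ContDiffOn ℝ ∞ T s :=
    equiv.symm.contDiff.comp_contDiffOn (hd.prodMk B.contDiff.contDiffOn)
  have hT' : HasFDerivAt T ((ContinuousLinearEquiv.refl ℝ E : E ≃L[ℝ] E) : E →L[ℝ] E) (φ x) := by
    have e1 := (equiv.symm : E' × F →L[ℝ] E).hasFDerivAt.comp (φ x)
      (hd'.prodMk B.hasFDerivAt)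
    refine e1.congr_fderiv ?_
    rw [← hequiv]
    ext z
    simp
  have h1 := hT.isLocalDiffeomorphAt hs hxs hT'
  have h2 := (φ.isLocalDiffeomorphAt hφ (mem_chart_source E x)).comp 𝓘(ℝ, E) _ h1
  obtain ⟨χ, hχ, hxχ, hχT⟩ := h2.exists_chart
  have hU : IsOpen (φ.source ∩ φ ⁻¹' s) := φ.isOpen_inter_preimage hs
  have hsrc : (χ.restr (φ.source ∩ φ ⁻¹' s)).source = χ.source ∩ (φ.source ∩ φ ⁻¹' s) := by
    rw [χ.restr_source, hU.interior_eq]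
  refine Manifold.IsSubmersionAtOfComplement.mk_of_continuousAt hf.continuous.continuousAt equiv
    (χ.restr (φ.source ∩ φ ⁻¹' s)) ψ (hsrc ▸ ⟨hxχ, mem_chart_source E x, hxs⟩)
    (mem_chart_source E' (f x)) (restr_mem_maximalAtlas _ hχ hU) hψ ?_
  intro e he
  have he' : e ∈ (χ.restr (φ.source ∩ φ ⁻¹' s)).target := by simpa [mfld_simps] using he
  have h3 : χ.symm e ∈ χ.source ∩ (φ.source ∩ φ ⁻¹' s) :=
    hsrc ▸ (χ.restr (φ.source ∩ φ ⁻¹' s)).map_target he'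
  have h4 : χ (χ.symm e) = e := (χ.restr (φ.source ∩ φ ⁻¹' s)).right_inv he'
  have h5 := hχT h3.1
  rw [h4] at h5
  have h6 : (equiv e).1 = ψ (f (χ.symm e)) := by
    have h7 := congrArg (fun z ↦ (equiv z).1) h5
    simpa [T, φ.left_inv h3.2.1] using h7.symm
  simpa [mfld_simps] using h6.symm

end LocalForms

/-! ### Derivatives and injectivity in smooth families -/

section Families

variable {W E E' : Type*} [NormedAddCommGroup W] [NormedSpace ℝ W]
  [NormedAddCommGroup E] [NormedSpace ℝ E]
  [NormedAddCommGroup E'] [NormedSpace ℝ E']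
  {K : Type*} [TopologicalSpace K] [ChartedSpace E K] [IsManifold 𝓘(ℝ, E) ∞ K]
  {M : Type*} [TopologicalSpace M] [ChartedSpace E' M] [IsManifold 𝓘(ℝ, E') ∞ M]
  {P : W → K → M} {u₀ : W} {x₀ : K}

/-- Near `(u₀, x₀)`, the partial derivatives `mfderiv (P u) x` of a smooth family agree, up to
isomorphisms of the source and the target, with a family of linear maps that is continuous at
`(u₀, x₀)`. -/
theorem ContMDiffAt.exists_continuousAt_mfderiv
    (hP : ContMDiffAt (𝓘(ℝ, W).prod 𝓘(ℝ, E)) 𝓘(ℝ, E') ∞ (Function.uncurry P) (u₀, x₀)) :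
    ∃ D : W × K → E →L[ℝ] E', ContinuousAt D (u₀, x₀) ∧ ∀ᶠ z in 𝓝 (u₀, x₀),
      (Function.Injective (D z) ↔
        Function.Injective (mfderiv 𝓘(ℝ, E) 𝓘(ℝ, E') (P z.1) z.2)) ∧
      (Function.Surjective (D z) ↔
        Function.Surjective (mfderiv 𝓘(ℝ, E) 𝓘(ℝ, E') (P z.1) z.2)) := by
  have : IsManifold 𝓘(ℝ, E) 1 K := IsManifold.of_le (n := ∞) (by simp)
  have : IsManifold 𝓘(ℝ, E') 1 M := IsManifold.of_le (n := ∞) (by simp)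
  -- The base point is made part of the parameter `z = (u, x)`, so that the derivative is controlled
  -- jointly in `u` and `x`.
  have hf : ContMDiffAt ((𝓘(ℝ, W).prod 𝓘(ℝ, E)).prod 𝓘(ℝ, E)) 𝓘(ℝ, E') ∞
      (Function.uncurry fun (z : W × K) (x : K) ↦ P z.1 x) ((u₀, x₀), x₀) :=
    ContMDiffAt.comp (f := fun y : (W × K) × K ↦ (y.1.1, y.2)) ((u₀, x₀), x₀) hP
      ((contMDiffAt_fst.comp _ contMDiffAt_fst).prodMk contMDiffAt_snd)
  have h := ContMDiffAt.mfderiv (m := 0) (x₀ := (u₀, x₀))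
    (fun (z : W × K) (x : K) ↦ P z.1 x) Prod.snd hf contMDiffAt_snd (by simp)
  refine ⟨_, h.continuousAt, ?_⟩
  have h1 : ∀ᶠ z : W × K in 𝓝 (u₀, x₀), z.2 ∈ (chartAt E x₀).source :=
    continuous_snd.continuousAt ((chartAt E x₀).open_source.mem_nhds (mem_chart_source E x₀))
  have h2 : ∀ᶠ z : W × K in 𝓝 (u₀, x₀), P z.1 z.2 ∈ (chartAt E' (P u₀ x₀)).source :=
    hP.continuousAt ((chartAt E' (P u₀ x₀)).open_source.mem_nhds (mem_chart_source E' _))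
  filter_upwards [h1, h2] with z hz1 hz2
  -- Tangent coordinates differ from `mfderiv` by derivatives of charts on both sides; these are
  -- invertible.
  rw [inTangentCoordinates_eq_mfderiv_comp hz1 hz2]
  obtain ⟨C, hC⟩ := isInvertible_mfderiv_extChartAt (I := 𝓘(ℝ, E')) (x := P u₀ x₀)
    (y := P z.1 z.2) (by simpa using hz2)
  obtain ⟨B, hB⟩ := isInvertible_mfderivWithin_extChartAt_symm (I := 𝓘(ℝ, E)) (x := x₀)
    (y := extChartAt 𝓘(ℝ, E) x₀ z.2)
    ((extChartAt 𝓘(ℝ, E) x₀).map_source (by simpa using hz1))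
  rw [← hC, ← hB]
  exact ⟨(C.injective.of_comp_iff _).trans (B.injective_comp _),
    (C.comp_surjective _).trans (B.surjective.of_comp_iff _)⟩

theorem ContMDiffAt.eventually_injective_mfderiv [FiniteDimensional ℝ E]
    (hP : ContMDiffAt (𝓘(ℝ, W).prod 𝓘(ℝ, E)) 𝓘(ℝ, E') ∞ (Function.uncurry P) (u₀, x₀))
    (h : Function.Injective (mfderiv 𝓘(ℝ, E) 𝓘(ℝ, E') (P u₀) x₀)) :
    ∀ᶠ z in 𝓝 (u₀, x₀), Function.Injective (mfderiv 𝓘(ℝ, E) 𝓘(ℝ, E') (P z.1) z.2) := by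
  obtain ⟨D, hD, hD'⟩ := hP.exists_continuousAt_mfderiv
  have := hD (ContinuousLinearMap.isOpen_injective.mem_nhds (hD'.self_of_nhds.1.2 h))
  filter_upwards [hD', this] with z hz hz'
  exact hz.1.1 hz'

theorem ContMDiffAt.eventually_surjective_mfderiv [FiniteDimensional ℝ E']
    (hP : ContMDiffAt (𝓘(ℝ, W).prod 𝓘(ℝ, E)) 𝓘(ℝ, E') ∞ (Function.uncurry P) (u₀, x₀))
    (h : Function.Surjective (mfderiv 𝓘(ℝ, E) 𝓘(ℝ, E') (P u₀) x₀)) :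
    ∀ᶠ z in 𝓝 (u₀, x₀), Function.Surjective (mfderiv 𝓘(ℝ, E) 𝓘(ℝ, E') (P z.1) z.2) := by
  obtain ⟨D, hD, hD'⟩ := hP.exists_continuousAt_mfderiv
  have := hD (ContinuousLinearMap.isOpen_surjective.mem_nhds (hD'.self_of_nhds.2.2 h))
  filter_upwards [hD', this] with z hz hz'
  exact hz.2.1 hz'

/-- A smooth family of maps is injective near `x₀`, uniformly in the parameter near `u₀`, if the
derivative of `P u₀` at `x₀` is injective. -/
theorem ContMDiff.eventually_injective_of_injective_mfderiv [FiniteDimensional ℝ W]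
    [FiniteDimensional ℝ E] [FiniteDimensional ℝ E']
    (hP : ContMDiff (𝓘(ℝ, W).prod 𝓘(ℝ, E)) 𝓘(ℝ, E') ∞ (Function.uncurry P))
    (h : Function.Injective (mfderiv 𝓘(ℝ, E) 𝓘(ℝ, E') (P u₀) x₀)) :
    ∀ᶠ z : W × K × K in 𝓝 (u₀, x₀, x₀), P z.1 z.2.1 = P z.1 z.2.2 → z.2.1 = z.2.2 := by
  set φ := chartAt E x₀
  set ψ := chartAt E' (P u₀ x₀)
  have hφ : φ ∈ IsManifold.maximalAtlas 𝓘(ℝ, E) ∞ K := IsManifold.chart_mem_maximalAtlas x₀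
  have hψ : ψ ∈ IsManifold.maximalAtlas 𝓘(ℝ, E') ∞ M := IsManifold.chart_mem_maximalAtlas _
  have hφx : φ.symm (φ x₀) = x₀ := φ.left_inv (mem_chart_source E x₀)
  let G : W × E → E' := fun z ↦ ψ (P z.1 (φ.symm z.2))
  have hG : ContDiffAt ℝ ∞ G (u₀, φ x₀) := by
    rw [← contMDiffAt_iff_contDiffAt]
    have e1 : ContMDiffAt 𝓘(ℝ, W × E) (𝓘(ℝ, W).prod 𝓘(ℝ, E)) ∞
        (fun z : W × E ↦ (z.1, φ.symm z.2)) (u₀, φ x₀) :=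
      contDiff_fst.contMDiff.contMDiffAt.prodMk
        ((contMDiffAt_symm_of_mem_maximalAtlas hφ (mem_chart_target E x₀)).comp (u₀, φ x₀)
          contDiff_snd.contMDiff.contMDiffAt)
    have e2 : ContMDiffAt 𝓘(ℝ, W × E) 𝓘(ℝ, E') ∞
        (fun z : W × E ↦ P z.1 (φ.symm z.2)) (u₀, φ x₀) :=
      hP.contMDiffAt.comp (u₀, φ x₀) e1
    refine ContMDiffAt.comp (u₀, φ x₀) (g := ψ) ?_ e2
    refine contMDiffAt_of_mem_maximalAtlas hψ ?_
    rw [hφx]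
    exact mem_chart_source E' _
  set A : E →L[ℝ] E' := mfderiv 𝓘(ℝ, E) 𝓘(ℝ, E') (P u₀) x₀
  have hPu : ContMDiff 𝓘(ℝ, E) 𝓘(ℝ, E') ∞ (P u₀) :=
    hP.comp (contMDiff_const.prodMk contMDiff_id)
  obtain ⟨L, hL⟩ := A.exists_leftInverse_of_injective h
  have hG' := hG.hasStrictFDerivAt (by simp)
  set G' := fderiv ℝ G (u₀, φ x₀)
  have hG'A : ∀ v, G' (0, v) = A v := by
    obtain ⟨-, -, -, -, -, -, hd⟩ := hPu.exists_contDiffOn_chart x₀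
    have e1 : HasFDerivAt (fun e : E ↦ ((u₀, e) : W × E)) (ContinuousLinearMap.inr ℝ W E) (φ x₀) :=
      hasFDerivAt_prodMk_right u₀ (φ x₀)
    have e2 : HasFDerivAt (fun e : E ↦ G (u₀, e)) (G'.comp (ContinuousLinearMap.inr ℝ W E)) (φ x₀) :=
      hG'.hasFDerivAt.comp (φ x₀) e1
    have e3 := e2.unique hd
    exact fun v ↦ DFunLike.congr_fun e3 v
  -- Keeping `u` as a component makes uniform injectivity of the family the local injectivity of one
  -- map; composing with the left inverse `L` of `A` gives that map source and target of equal
  -- dimension.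
  have hT' : HasStrictFDerivAt (fun z : W × E ↦ (z.1, L (G z)))
      ((ContinuousLinearMap.fst ℝ W E).prod (L.comp G')) (u₀, φ x₀) :=
    hasStrictFDerivAt_fst.prodMk (L.hasStrictFDerivAt.comp _ hG')
  have hinj : Function.Injective ((ContinuousLinearMap.fst ℝ W E).prod (L.comp G')) := by
    rw [injective_iff_map_eq_zero]
    rintro ⟨w, v⟩ hwv
    have h1 : w = 0 := congrArg Prod.fst hwv
    subst h1
    have h2 : L (G' (0, v)) = 0 := congrArg Prod.snd hwv
    rw [hG'A, hL] at h2
    rw [h2]; rfl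
  obtain ⟨e, he⟩ := ContinuousLinearMap.exists_equiv_of_bijective _
    ⟨hinj, LinearMap.surjective_of_injective (f := ((ContinuousLinearMap.fst ℝ W E).prod
      (L.comp G')).toLinearMap) hinj⟩
  rw [← he] at hT'
  set R := hT'.toOpenPartialHomeomorph _
  have hR : (u₀, φ x₀) ∈ R.source := hT'.mem_toOpenPartialHomeomorph_source
  have hφc : ContinuousAt φ x₀ := φ.continuousAt (mem_chart_source E x₀)
  have c1 : ∀ᶠ z : W × K × K in 𝓝 (u₀, x₀, x₀), (z.1, φ z.2.1) ∈ R.source := by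
    refine ContinuousAt.eventually_mem (f := fun z : W × K × K ↦ (z.1, φ z.2.1)) ?_
      (R.open_source.mem_nhds hR)
    exact continuousAt_fst.prodMk
      (ContinuousAt.comp (g := φ) (f := fun z : W × K × K ↦ z.2.1) hφc (by fun_prop))
  have c2 : ∀ᶠ z : W × K × K in 𝓝 (u₀, x₀, x₀), (z.1, φ z.2.2) ∈ R.source := by
    refine ContinuousAt.eventually_mem (f := fun z : W × K × K ↦ (z.1, φ z.2.2)) ?_
      (R.open_source.mem_nhds hR)
    exact continuousAt_fst.prodMk
      (ContinuousAt.comp (g := φ) (f := fun z : W × K × K ↦ z.2.2) hφc (by fun_prop))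
  have hsrc := φ.open_source.mem_nhds (mem_chart_source E x₀)
  have c3 : ∀ᶠ z : W × K × K in 𝓝 (u₀, x₀, x₀), z.2.1 ∈ φ.source :=
    ContinuousAt.eventually_mem (f := fun z : W × K × K ↦ z.2.1) (by fun_prop) hsrc
  have c4 : ∀ᶠ z : W × K × K in 𝓝 (u₀, x₀, x₀), z.2.2 ∈ φ.source :=
    ContinuousAt.eventually_mem (f := fun z : W × K × K ↦ z.2.2) (by fun_prop) hsrc
  filter_upwards [c1, c2, c3, c4] with z h1 h2 h3 h4 hz
  have : R (z.1, φ z.2.1) = R (z.1, φ z.2.2) := by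
    change (z.1, L (G (z.1, φ z.2.1))) = (z.1, L (G (z.1, φ z.2.2)))
    simp only [G, φ.left_inv h3, φ.left_inv h4, hz]
  exact φ.injOn h3 h4 (congrArg Prod.snd (R.injOn h1 h2 this))

end Families

/-! ### Plots of the functional diffeology as smooth families -/

section Plots

variable {k m : ℕ} {K M : Type*}
  [TopologicalSpace K] [ChartedSpace (EuclideanSpace ℝ (Fin k)) K] [IsManifold (𝓡 k) ∞ K]
  [TopologicalSpace M] [ChartedSpace (EuclideanSpace ℝ (Fin m)) M]

/-- A map `p : ℝⁿ → C^∞(K, M)` is a plot of the functional diffeology only if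
`(u, x) ↦ p u x` is a smooth map of manifolds. -/
theorem contMDiff_uncurry_of_isPlot {n : ℕ} {p : EuclideanSpace ℝ (Fin n) → C^∞⟮𝓡 k, K; 𝓡 m, M⟯}
    (hp : @IsPlot _ (smoothMapsDiffeology k m K M) n p) :
    ContMDiff ((𝓡 n).prod (𝓡 k)) (𝓡 m) ∞ (Function.uncurry fun u ↦ (p u : K → M)) := by
  rintro ⟨u₀, x₀⟩
  set φ := chartAt (EuclideanSpace ℝ (Fin k)) x₀
  have hφ : φ ∈ IsManifold.maximalAtlas (𝓡 k) ∞ K := IsManifold.chart_mem_maximalAtlas x₀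
  obtain ⟨r, hr, hball⟩ := Metric.isOpen_iff.1 φ.open_target (φ x₀) (mem_chart_target _ x₀)
  -- Plots are defined on a whole Euclidean space, so a ball in the chart target is reparametrized
  -- by all of `ℝᵏ`.
  let b := OpenPartialHomeomorph.univBall (φ x₀) r
  have hbt : b.target = Metric.ball (φ x₀) r := OpenPartialHomeomorph.univBall_target _ hr
  have hbs : b.source = Set.univ := OpenPartialHomeomorph.univBall_source _ _
  have hbφ : ∀ v, b v ∈ φ.target := fun v ↦ hball (hbt ▸ b.map_source (hbs ▸ Set.mem_univ v))
  let l := Module.finrank ℝ (EuclideanSpace ℝ (Fin n) × EuclideanSpace ℝ (Fin k))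
  let T := toEuclidean (E := EuclideanSpace ℝ (Fin n) × EuclideanSpace ℝ (Fin k))
  have hq1 : ContDiff ℝ ∞ fun v ↦ (T.symm v).1 := contDiff_fst.comp T.symm.contDiff
  have hq2 : ContMDiff (𝓡 l) (𝓡 k) ∞ fun v ↦ φ.symm (b (T.symm v).2) := by
    refine (contMDiffOn_symm_of_mem_maximalAtlas hφ).comp_contMDiff (ContDiff.contMDiff ?_)
      fun v ↦ hbφ _
    exact OpenPartialHomeomorph.contDiff_univBall.comp (contDiff_snd.comp T.symm.contDiff)
  have hplot : ContMDiff (𝓡 l) (𝓡 m) ∞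
      fun v ↦ p (T.symm v).1 (φ.symm (b (T.symm v).2)) :=
    hp l (fun v ↦ ((T.symm v).1, φ.symm (b (T.symm v).2))) ⟨hq1.isPlot, hq2⟩
  have hb' : ContDiffAt ℝ ∞ b.symm (φ x₀) :=
    OpenPartialHomeomorph.contDiffOn_univBall_symm.contDiffAt (Metric.ball_mem_nhds _ hr)
  -- A local inverse of the parametrization: composing it with `hplot` recovers the family near
  -- `(u₀, x₀)`.
  have hs : ContMDiffAt ((𝓡 n).prod (𝓡 k)) (𝓡 l) ∞
      (fun z : EuclideanSpace ℝ (Fin n) × K ↦ T (z.1, b.symm (φ z.2))) (u₀, x₀) := by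
    refine T.contDiff.contMDiff.contMDiffAt.comp (u₀, x₀)
      (ContMDiffAt.prodMk_space contMDiffAt_fst ?_)
    refine ContMDiffAt.comp (u₀, x₀) (g := b.symm) hb'.contMDiffAt ?_
    exact (contMDiffAt_of_mem_maximalAtlas hφ (mem_chart_source _ x₀)).comp (u₀, x₀) contMDiffAt_snd
  refine (hplot.contMDiffAt.comp (u₀, x₀) hs).congr_of_eventuallyEq ?_
  have h1 : ∀ᶠ z : EuclideanSpace ℝ (Fin n) × K in 𝓝 (u₀, x₀), z.2 ∈ φ.source :=
    continuousAt_snd (φ.open_source.mem_nhds (mem_chart_source _ x₀))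
  have h2 : ∀ᶠ z : EuclideanSpace ℝ (Fin n) × K in 𝓝 (u₀, x₀), φ z.2 ∈ Metric.ball (φ x₀) r :=
    ((φ.continuousAt (mem_chart_source _ x₀)).comp (f := Prod.snd)
      (x := (u₀, x₀)) continuousAt_snd) (Metric.ball_mem_nhds _ hr)
  filter_upwards [h1, h2] with z hz1 hz2
  rw [← hbt] at hz2
  simp [b.right_inv hz2, φ.left_inv hz1, Function.uncurry]

/-- A set of smooth maps is D-open if membership is an open condition along each smooth family. -/
theorem isDOpen_of_eventually {A : Set C^∞⟮𝓡 k, K; 𝓡 m, M⟯}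
    (h : ∀ (n : ℕ) (p : EuclideanSpace ℝ (Fin n) → C^∞⟮𝓡 k, K; 𝓡 m, M⟯),
      ContMDiff ((𝓡 n).prod (𝓡 k)) (𝓡 m) ∞ (Function.uncurry fun u ↦ (p u : K → M)) →
      ∀ u₀, p u₀ ∈ A → ∀ᶠ u in 𝓝 u₀, p u ∈ A) : IsDOpen A := by
  let := smoothMapsDiffeology k m K M
  refine isOpen_iff_preimages_plots.2 fun n p hp ↦ isOpen_iff_mem_nhds.2 fun u₀ hu₀ ↦ ?_
  exact h n p (contMDiff_uncurry_of_isPlot hp) u₀ hu₀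

end Plots

/-- The inverse of a bijective local diffeomorphism is smooth, smoothness being local. This
separates the condition on derivatives from the global one. -/
theorem exists_diffeomorph_coe_eq_iff {k m : ℕ} {K M : Type*}
    [TopologicalSpace K] [ChartedSpace (EuclideanSpace ℝ (Fin k)) K]
    [TopologicalSpace M] [ChartedSpace (EuclideanSpace ℝ (Fin m)) M] {f : K → M} :
    (∃ Φ : K ≃ₘ^∞⟮𝓡 k, 𝓡 m⟯ M, ⇑Φ = f) ↔
      IsLocalDiffeomorph (𝓡 k) (𝓡 m) ∞ f ∧ Function.Bijective f := by
  constructor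
  · rintro ⟨Φ, rfl⟩
    exact ⟨Φ.isLocalDiffeomorph, Φ.bijective⟩
  · rintro ⟨h, hb⟩
    exact ⟨h.diffeomorphOfBijective hb, rfl⟩

/-! ### Immersions, submersions and étale maps through derivatives -/

section Characterizations

variable {k m : ℕ} {K M : Type*}
  [TopologicalSpace K] [ChartedSpace (EuclideanSpace ℝ (Fin k)) K] [IsManifold (𝓡 k) ∞ K]
  [TopologicalSpace M] [ChartedSpace (EuclideanSpace ℝ (Fin m)) M] [IsManifold (𝓡 m) ∞ M]

/-- The complement is chosen before any point, with truncated dimension `m - k`; the inequality `k ≤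
m` comes from injectivity at a point, so an empty `K` does no harm. -/
theorem ContMDiff.isImmersion_iff {f : K → M} (hf : ContMDiff (𝓡 k) (𝓡 m) ∞ f) :
    Manifold.IsImmersion (𝓡 k) (𝓡 m) ∞ f ↔
      ∀ x, Function.Injective (mfderiv (𝓡 k) (𝓡 m) f x) := by
  refine ⟨fun h x ↦ h.injective_mfderiv x, fun h ↦
    ⟨EuclideanSpace ℝ (Fin (m - k)), inferInstance, inferInstance, fun x ↦ ?_⟩⟩
  have hle := LinearMap.finrank_le_finrank_of_injective (R := ℝ)
    (M := EuclideanSpace ℝ (Fin k)) (M' := EuclideanSpace ℝ (Fin m))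
    (f := (mfderiv (𝓡 k) (𝓡 m) f x).toLinearMap) (h x)
  simp only [finrank_euclideanSpace_fin] at hle
  refine hf.isImmersionAtOfComplement (h x) ?_
  simp only [finrank_euclideanSpace_fin]
  omega

theorem ContMDiff.isSubmersion_iff {f : K → M} (hf : ContMDiff (𝓡 k) (𝓡 m) ∞ f) :
    Manifold.IsSubmersion (𝓡 k) (𝓡 m) ∞ f ↔
      ∀ x, Function.Surjective (mfderiv (𝓡 k) (𝓡 m) f x) := by
  refine ⟨fun h x ↦ h.surjective_mfderiv x, fun h ↦
    ⟨EuclideanSpace ℝ (Fin (k - m)), inferInstance, inferInstance, fun x ↦ ?_⟩⟩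
  have hle := LinearMap.finrank_le_finrank_of_surjective (R := ℝ)
    (M := EuclideanSpace ℝ (Fin k)) (M' := EuclideanSpace ℝ (Fin m))
    (f := (mfderiv (𝓡 k) (𝓡 m) f x).toLinearMap) (h x)
  simp only [finrank_euclideanSpace_fin] at hle
  refine hf.isSubmersionAtOfComplement (h x) ?_
  simp only [finrank_euclideanSpace_fin]
  omega

theorem ContMDiff.isLocalDiffeomorph_iff {f : K → M} (hf : ContMDiff (𝓡 k) (𝓡 m) ∞ f) :
    IsLocalDiffeomorph (𝓡 k) (𝓡 m) ∞ f ↔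
      ∀ x, Function.Bijective (mfderiv (𝓡 k) (𝓡 m) f x) :=
  ⟨fun h x ↦ (h x).bijective_mfderiv, fun h x ↦ hf.isLocalDiffeomorphAt (h x)⟩

end Characterizations

/-! ### Transversality as surjectivity of a derivative -/

section Transversality

/-- If `B` is onto the kernel of a surjection `Q`, then the ranges of `A` and `B` span the whole
space iff `Q ∘ A` is surjective. -/
theorem range_sup_range_eq_top_iff {R V V₁ V₂ V₃ : Type*} [Ring R] [AddCommGroup V] [Module R V]
    [AddCommGroup V₁] [Module R V₁] [AddCommGroup V₂] [Module R V₂] [AddCommGroup V₃] [Module R V₃]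
    (A : V₁ →ₗ[R] V) (B : V₂ →ₗ[R] V) (Q : V →ₗ[R] V₃) (hQ : Function.Surjective Q)
    (hB : LinearMap.range B = LinearMap.ker Q) :
    LinearMap.range A ⊔ LinearMap.range B = ⊤ ↔ Function.Surjective (Q ∘ A) := by
  rw [hB, Submodule.eq_top_iff']
  constructor
  · intro h w
    obtain ⟨t, rfl⟩ := hQ w
    obtain ⟨_, ⟨v, rfl⟩, z, hz, rfl⟩ := Submodule.mem_sup.1 (h t)
    exact ⟨v, by simp [LinearMap.mem_ker.1 hz]⟩
  · intro h t
    obtain ⟨v, hv⟩ := h (Q t)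
    refine Submodule.mem_sup.2 ⟨A v, ⟨v, rfl⟩, t - A v, ?_, by simp⟩
    simp only [Function.comp_apply] at hv
    simp [hv]

variable {E E' E'' F : Type*} [NormedAddCommGroup E] [NormedSpace ℝ E]
  [NormedAddCommGroup E'] [NormedSpace ℝ E'] [NormedAddCommGroup E''] [NormedSpace ℝ E'']
  [NormedAddCommGroup F] [NormedSpace ℝ F]
  {K : Type*} [TopologicalSpace K] [ChartedSpace E K]
  {M : Type*} [TopologicalSpace M] [ChartedSpace E' M]
  {N : Type*} [TopologicalSpace N] [ChartedSpace E'' N]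

/-- In charts `φ` of `N` and `ψ` of `M` in which `ι : N → M` is the inclusion of a factor,
transversality of `f` to `ι` at a point means that the other component of `f` has surjective
derivative. -/
theorem range_mfderiv_sup_range_mfderiv_eq_top_iff {f : K → M} {ι : N → M}
    (hι : ContMDiff 𝓘(ℝ, E'') 𝓘(ℝ, E') ∞ ι)
    {φ : OpenPartialHomeomorph N E''} {ψ : OpenPartialHomeomorph M E'}
    (hφ : φ ∈ IsManifold.maximalAtlas 𝓘(ℝ, E'') ∞ N)
    (hψ : ψ ∈ IsManifold.maximalAtlas 𝓘(ℝ, E') ∞ M)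
    (equiv : (E'' × F) ≃L[ℝ] E')
    (h : Set.EqOn ((ψ.extend 𝓘(ℝ, E')) ∘ ι ∘ (φ.extend 𝓘(ℝ, E'')).symm) (equiv ∘ (·, 0))
      (φ.extend 𝓘(ℝ, E'')).target)
    {x : K} {y : N} (hy : y ∈ φ.source) (hψy : ι y ∈ ψ.source) (hxy : f x = ι y)
    -- Derivatives enter as plain maps into `E'`, which avoids transport between the tangent spaces
    -- at `f x` and `ι y`.
    {A : E →L[ℝ] E'} (hA : HasMFDerivAt 𝓘(ℝ, E) 𝓘(ℝ, E') f x A)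
    {B : E'' →L[ℝ] E'} (hB : HasMFDerivAt 𝓘(ℝ, E'') 𝓘(ℝ, E') ι y B) :
    LinearMap.range A.toLinearMap ⊔
      LinearMap.range B.toLinearMap = ⊤ ↔
    Function.Surjective (mfderiv 𝓘(ℝ, E) 𝓘(ℝ, F) (fun x ↦ (equiv.symm (ψ (f x))).2) x) := by
  have hψx : f x ∈ ψ.source := hxy ▸ hψy
  have key := mfderiv_comp_of_eqOn_charts hι hφ hψ hy hψy
    ((equiv : E'' × F →L[ℝ] E').comp (ContinuousLinearMap.inl ℝ E'' F)) h
  rw [hB.mfderiv] at key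
  have hψb := ψ.bijective_mfderiv hψ hψy
  have hφb := φ.bijective_mfderiv hφ hy
  let π : E' →L[ℝ] F :=
    (ContinuousLinearMap.snd ℝ E'' F).comp (equiv.symm : E' →L[ℝ] E'' × F)
  let D : E' →L[ℝ] E' := mfderiv 𝓘(ℝ, E') 𝓘(ℝ, E') ψ (ι y)
  have hd : (mfderiv 𝓘(ℝ, E) 𝓘(ℝ, F) (fun x ↦ (equiv.symm (ψ (f x))).2) x : E →L[ℝ] F) =
      (π.comp D).comp A := by
    rw [← hA.mfderiv]
    have hdψ : MDifferentiableAt 𝓘(ℝ, E') 𝓘(ℝ, E') ψ (f x) :=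
      (ψ.isLocalDiffeomorphAt hψ hψx).mdifferentiableAt (by simp)
    have hdf : MDifferentiableAt 𝓘(ℝ, E) 𝓘(ℝ, E') f x := hA.mdifferentiableAt
    have h1 := mfderiv_comp x (π.differentiableAt.mdifferentiableAt (x := ψ (f x)))
      (hdψ.comp x hdf)
    rw [mfderiv_comp x hdψ hdf, mfderiv_eq_fderiv, π.fderiv, hxy] at h1
    exact h1
  have hQs : Function.Surjective (π.comp D) := by
    intro w
    obtain ⟨t, ht⟩ := hψb.2 (equiv (0, w))
    refine ⟨t, ?_⟩
    have ht' : D t = equiv (0, w) := ht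
    change (equiv.symm (D t)).2 = w
    rw [ht', equiv.symm_apply_apply]
  -- The slice form of `ι` identifies its tangent space with the kernel of the derivative of the
  -- transverse coordinate.
  have hBker : LinearMap.range B.toLinearMap =
      LinearMap.ker (π.comp D).toLinearMap := by
    ext t
    constructor
    · rintro ⟨s, rfl⟩
      have hs : D (B s) =
        equiv (mfderiv 𝓘(ℝ, E'') 𝓘(ℝ, E'') φ y s, 0) := key s
      change (equiv.symm (D (B s))).2 = 0
      rw [hs, equiv.symm_apply_apply]
    · intro ht
      have ht' : (equiv.symm (D t)).2 = 0 := ht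
      obtain ⟨s, hs⟩ := hφb.2 (equiv.symm (D t)).1
      refine ⟨s, hψb.1 ?_⟩
      refine (key s).trans ?_
      rw [hs]
      change equiv ((equiv.symm (D t)).1, 0) = D t
      rw [← ht']
      exact equiv.apply_symm_apply (D t)
  have := range_sup_range_eq_top_iff A.toLinearMap
    B.toLinearMap (π.comp D).toLinearMap hQs hBker
  rw [this]
  change _ ↔ Function.Surjective
    (mfderiv 𝓘(ℝ, E) 𝓘(ℝ, F) (fun x ↦ (equiv.symm (ψ (f x))).2) x : E →L[ℝ] F)
  rw [hd]
  rfl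

end Transversality

/-! ### D-openness of the six classes -/

section DOpen

variable {k m : ℕ} {K M : Type*} [TopologicalSpace K] [CompactSpace K]
  [ChartedSpace (EuclideanSpace ℝ (Fin k)) K] [IsManifold (𝓡 k) ∞ K]
  [TopologicalSpace M] [ChartedSpace (EuclideanSpace ℝ (Fin m)) M]

/-- Tube lemma for D-openness: a pointwise condition that is open in smooth families defines a
D-open set. -/
theorem isDOpen_of_forall_eventually {Q : C^∞⟮𝓡 k, K; 𝓡 m, M⟯ → K → Prop}
    (h : ∀ (n : ℕ) (p : EuclideanSpace ℝ (Fin n) → C^∞⟮𝓡 k, K; 𝓡 m, M⟯),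
      ContMDiff ((𝓡 n).prod (𝓡 k)) (𝓡 m) ∞ (Function.uncurry fun u ↦ (p u : K → M)) →
      ∀ u₀ x₀, Q (p u₀) x₀ → ∀ᶠ z : EuclideanSpace ℝ (Fin n) × K in 𝓝 (u₀, x₀), Q (p z.1) z.2) :
    IsDOpen {f | ∀ x, Q f x} :=
  isDOpen_of_eventually fun n p hp u₀ hu₀ ↦ by
    have := isCompact_univ.eventually_forall_of_forall_eventually (x₀ := u₀)
      (P := fun u x ↦ Q (p u) x) fun x _ ↦ h n p hp u₀ x (hu₀ x)
    filter_upwards [this] with u hu x using hu x (Set.mem_univ x)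

theorem isDOpen_transversal {d : ℕ} {N : Set M} [ChartedSpace (EuclideanSpace ℝ (Fin d)) N]
    (hN : IsClosedSubmanifold d m N) :
    IsDOpen {f : C^∞⟮𝓡 k, K; 𝓡 m, M⟯ | IsTransversalTo d f N} := by
  refine isDOpen_of_forall_eventually fun n p hp u₀ x₀ h ↦ ?_
  have hp₀ := hp.contMDiffAt (x := (u₀, x₀))
  by_cases hx₀ : p u₀ x₀ ∈ N
  swap
  -- Nearby values stay off the closed set `N`, where the condition is vacuous.
  · filter_upwards [hp₀.continuousAt (hN.isClosed.isOpen_compl.mem_nhds hx₀)] with z hz hz'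
    exact absurd hz' hz
  have hι := hN.isSmoothEmbedding.contMDiff
  obtain ⟨F, _, _, himm⟩ := hN.isSmoothEmbedding.isImmersion
  have himm := himm ⟨p u₀ x₀, hx₀⟩
  set φ := himm.domChart
  set ψ := himm.codChart
  have hφ := himm.domChart_mem_maximalAtlas
  have hψ := himm.codChart_mem_maximalAtlas
  -- `F` is a factor of a space isomorphic to `ℝᵐ`; finite dimension is what makes surjectivity onto
  -- it open.
  have : FiniteDimensional ℝ F := by
    have : FiniteDimensional ℝ (EuclideanSpace ℝ (Fin d) × F) :=
      himm.equiv.symm.toLinearEquiv.finiteDimensional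
    exact Module.Finite.of_surjective (LinearMap.snd ℝ (EuclideanSpace ℝ (Fin d)) F)
      Prod.snd_surjective
  -- `N` carries the subspace topology, so points of `N` close to `p u₀ x₀` in `M` lie in the slice
  -- chart `φ`.
  obtain ⟨V, hV, hVφ⟩ := isOpen_induced_iff.1 φ.open_source
  have hx₀V : p u₀ x₀ ∈ V := by
    have : (⟨p u₀ x₀, hx₀⟩ : N) ∈ φ.source := himm.mem_domChart_source
    rw [← hVφ] at this
    exact this
  have hiff : ∀ u x (hx : p u x ∈ N), p u x ∈ V →
      (_ ↔ Function.Surjective _) := fun u x hx hxV ↦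
    range_mfderiv_sup_range_mfderiv_eq_top_iff hι hφ hψ himm.equiv
      himm.writtenInCharts (x := x) (y := ⟨p u x, hx⟩)
      (show (⟨p u x, hx⟩ : N) ∈ φ.source from hVφ ▸ hxV)
      (himm.source_subset_preimage_source
        (show (⟨p u x, hx⟩ : N) ∈ φ.source from hVφ ▸ hxV)) rfl
      ((p u).contMDiff.mdifferentiableAt (by simp)).hasMFDerivAt
      (hι.mdifferentiableAt (by simp)).hasMFDerivAt
  have hg : ContMDiffAt ((𝓡 n).prod (𝓡 k)) 𝓘(ℝ, F) ∞
      (Function.uncurry fun u x ↦ (himm.equiv.symm (ψ (p u x))).2) (u₀, x₀) := by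
    have e1 : ContMDiffAt ((𝓡 n).prod (𝓡 k)) (𝓡 m) ∞
        (fun z : EuclideanSpace ℝ (Fin n) × K ↦ ψ (p z.1 z.2)) (u₀, x₀) :=
      ContMDiffAt.comp (u₀, x₀) (g := ψ)
        (contMDiffAt_of_mem_maximalAtlas hψ himm.mem_codChart_source) hp₀
    exact (contDiff_snd.comp himm.equiv.symm.contDiff).contMDiff.contMDiffAt.comp (u₀, x₀) e1
  have hsurj := hg.eventually_surjective_mfderiv ((hiff u₀ x₀ hx₀ hx₀V).1 (h hx₀))
  filter_upwards [hsurj, hp₀.continuousAt (hV.mem_nhds hx₀V)] with z hz hzV hzN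
  exact (hiff z.1 z.2 hzN hzV).2 hz

variable [IsManifold (𝓡 m) ∞ M]

theorem isDOpen_immersions :
    IsDOpen {f : C^∞⟮𝓡 k, K; 𝓡 m, M⟯ | Manifold.IsImmersion (𝓡 k) (𝓡 m) ∞ f} := by
  simp only [fun f : C^∞⟮𝓡 k, K; 𝓡 m, M⟯ ↦ f.contMDiff.isImmersion_iff]
  exact isDOpen_of_forall_eventually fun n p hp u₀ x₀ h ↦
    (hp.contMDiffAt (x := (u₀, x₀))).eventually_injective_mfderiv h

theorem isDOpen_submersions :
    IsDOpen {f : C^∞⟮𝓡 k, K; 𝓡 m, M⟯ | Manifold.IsSubmersion (𝓡 k) (𝓡 m) ∞ f} := by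
  simp only [fun f : C^∞⟮𝓡 k, K; 𝓡 m, M⟯ ↦ f.contMDiff.isSubmersion_iff]
  exact isDOpen_of_forall_eventually fun n p hp u₀ x₀ h ↦
    (hp.contMDiffAt (x := (u₀, x₀))).eventually_surjective_mfderiv h

theorem isDOpen_localDiffeomorphs :
    IsDOpen {f : C^∞⟮𝓡 k, K; 𝓡 m, M⟯ | IsLocalDiffeomorph (𝓡 k) (𝓡 m) ∞ f} := by
  simp only [fun f : C^∞⟮𝓡 k, K; 𝓡 m, M⟯ ↦ f.contMDiff.isLocalDiffeomorph_iff]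
  refine isDOpen_of_forall_eventually fun n p hp u₀ x₀ h ↦ ?_
  have hp := hp.contMDiffAt (x := (u₀, x₀))
  exact (hp.eventually_injective_mfderiv h.1).and (hp.eventually_surjective_mfderiv h.2)

/-- In a smooth family, injective immersions of a compact manifold stay injective. -/
theorem eventually_injective_of_injective_immersion [T2Space M] {n : ℕ}
    {p : EuclideanSpace ℝ (Fin n) → C^∞⟮𝓡 k, K; 𝓡 m, M⟯}
    (hp : ContMDiff ((𝓡 n).prod (𝓡 k)) (𝓡 m) ∞ (Function.uncurry fun u ↦ (p u : K → M)))
    {u₀ : EuclideanSpace ℝ (Fin n)} (hinj : Function.Injective (p u₀))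
    (himm : ∀ x, Function.Injective (mfderiv (𝓡 k) (𝓡 m) (p u₀) x)) :
    ∀ᶠ u in 𝓝 u₀, Function.Injective (p u) := by
  have key := isCompact_univ.eventually_forall_of_forall_eventually (x₀ := u₀) (Y := K × K)
    (P := fun u y ↦ p u y.1 = p u y.2 → y.1 = y.2) ?_
  · filter_upwards [key] with u hu x y hxy using hu (x, y) (Set.mem_univ _) hxy
  -- The diagonal needs the derivative at `x`; off it, distinct values stay distinct by continuity.
  rintro ⟨x, y⟩ -
  obtain rfl | hxy := eq_or_ne x y
  · exact hp.eventually_injective_of_injective_mfderiv (himm x)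
  · have hc := hp.continuous
    have h1 : Continuous fun z : EuclideanSpace ℝ (Fin n) × K × K ↦ p z.1 z.2.1 :=
      hc.comp (f := fun z : EuclideanSpace ℝ (Fin n) × K × K ↦ (z.1, z.2.1)) (by fun_prop)
    have h2 : Continuous fun z : EuclideanSpace ℝ (Fin n) × K × K ↦ p z.1 z.2.2 :=
      hc.comp (f := fun z : EuclideanSpace ℝ (Fin n) × K × K ↦ (z.1, z.2.2)) (by fun_prop)
    filter_upwards [(isOpen_ne_fun h1 h2).mem_nhds
      (show (u₀, x, y) ∈ {z : EuclideanSpace ℝ (Fin n) × K × K | p z.1 z.2.1 ≠ p z.1 z.2.2} from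
        hinj.ne hxy)] with z hz hz'
    exact absurd hz' hz

/-- A continuous injection from a compact space to a Hausdorff space is a closed embedding, so the
topological condition reduces to injectivity. -/
theorem isSmoothEmbedding_iff_of_compactSpace [T2Space M] {f : C^∞⟮𝓡 k, K; 𝓡 m, M⟯} :
    Manifold.IsSmoothEmbedding (𝓡 k) (𝓡 m) ∞ f ↔
      (∀ x, Function.Injective (mfderiv (𝓡 k) (𝓡 m) f x)) ∧ Function.Injective f := by
  rw [Manifold.isSmoothEmbedding_iff, f.contMDiff.isImmersion_iff]
  exact and_congr_right fun _ ↦ ⟨fun h ↦ h.injective, fun h ↦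
    (f.contMDiff.continuous.isClosedEmbedding h).isEmbedding⟩

theorem isDOpen_smoothEmbeddings [T2Space M] :
    IsDOpen {f : C^∞⟮𝓡 k, K; 𝓡 m, M⟯ | Manifold.IsSmoothEmbedding (𝓡 k) (𝓡 m) ∞ f} := by
  refine isDOpen_of_eventually fun n p hp u₀ hu₀ ↦ ?_
  obtain ⟨himm, hinj⟩ := isSmoothEmbedding_iff_of_compactSpace.1 hu₀
  have h1 := isCompact_univ.eventually_forall_of_forall_eventually (x₀ := u₀)
    (P := fun u x ↦ Function.Injective (mfderiv (𝓡 k) (𝓡 m) (p u) x)) fun x _ ↦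
      (hp.contMDiffAt (x := (u₀, x))).eventually_injective_mfderiv (himm x)
  filter_upwards [h1, eventually_injective_of_injective_immersion hp hinj himm] with u hu hu'
  exact isSmoothEmbedding_iff_of_compactSpace.2 ⟨fun x ↦ hu x (Set.mem_univ x), hu'⟩

/-- The étale condition and injectivity persist as before. Surjectivity needs no connectedness of
`K` or `M`: moving the parameter joins each point of `M` to the image of `p u`. -/
theorem isDOpen_diffeomorphs [T2Space M] :
    IsDOpen {f : C^∞⟮𝓡 k, K; 𝓡 m, M⟯ | ∃ Φ : K ≃ₘ^∞⟮𝓡 k, 𝓡 m⟯ M, ⇑Φ = ⇑f} := by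
  simp only [exists_diffeomorph_coe_eq_iff]
  refine isDOpen_of_eventually fun n p hp u₀ ⟨het, hbij⟩ ↦ ?_
  have hb := (p u₀).contMDiff.isLocalDiffeomorph_iff.1 het
  have h1 := isCompact_univ.eventually_forall_of_forall_eventually (x₀ := u₀)
    (P := fun u x ↦ Function.Bijective (mfderiv (𝓡 k) (𝓡 m) (p u) x)) fun x _ ↦
      ((hp.contMDiffAt (x := (u₀, x))).eventually_injective_mfderiv (hb x).1).and
        ((hp.contMDiffAt (x := (u₀, x))).eventually_surjective_mfderiv (hb x).2)
  filter_upwards [h1, eventually_injective_of_injective_immersion hp hbij.1 fun x ↦ (hb x).1]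
    with u hu hu'
  have hetu := (p u).contMDiff.isLocalDiffeomorph_iff.2 fun x ↦ hu x (Set.mem_univ x)
  refine ⟨hetu, hu', fun y ↦ ?_⟩
  -- The image of `p u` is clopen, and `p u x` lies in the component of `y = p u₀ x`.
  obtain ⟨x, rfl⟩ := hbij.2 y
  have hclopen : IsClopen (Set.range (p u)) :=
    ⟨(isCompact_range (p u).contMDiff.continuous).isClosed, hetu.isOpen_range⟩
  have hcont : Continuous fun v ↦ p v x :=
    hp.continuous.comp (f := fun v ↦ (v, x)) (by fun_prop)
  have hconn : IsPreconnected (Set.range fun v ↦ p v x) := isPreconnected_range hcont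
  exact hconn.subset_isClopen hclopen ⟨p u x, ⟨u, rfl⟩, ⟨x, rfl⟩⟩ ⟨u₀, rfl⟩

end DOpen

theorem theorem1p6 {k m : ℕ} {K M : Type*}
    [TopologicalSpace K] [T2Space K] [SecondCountableTopology K] [CompactSpace K]
    [ChartedSpace (EuclideanSpace ℝ (Fin k)) K] [IsManifold (𝓡 k) ∞ K]
    [TopologicalSpace M] [T2Space M] [SecondCountableTopology M]
    [ChartedSpace (EuclideanSpace ℝ (Fin m)) M] [IsManifold (𝓡 m) ∞ M] :
    IsDOpen {f : C^∞⟮𝓡 k, K; 𝓡 m, M⟯ | ∃ Φ : K ≃ₘ^∞⟮𝓡 k, 𝓡 m⟯ M, ⇑Φ = ⇑f} ∧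
    IsDOpen {f : C^∞⟮𝓡 k, K; 𝓡 m, M⟯ | IsLocalDiffeomorph (𝓡 k) (𝓡 m) ∞ f} ∧
    IsDOpen {f : C^∞⟮𝓡 k, K; 𝓡 m, M⟯ | Manifold.IsSubmersion (𝓡 k) (𝓡 m) ∞ f} ∧
    IsDOpen {f : C^∞⟮𝓡 k, K; 𝓡 m, M⟯ | Manifold.IsImmersion (𝓡 k) (𝓡 m) ∞ f} ∧
    IsDOpen {f : C^∞⟮𝓡 k, K; 𝓡 m, M⟯ | Manifold.IsSmoothEmbedding (𝓡 k) (𝓡 m) ∞ f} ∧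
    ∀ (d : ℕ) (N : Set M) [ChartedSpace (EuclideanSpace ℝ (Fin d)) N],
      IsClosedSubmanifold d m N →
        IsDOpen {f : C^∞⟮𝓡 k, K; 𝓡 m, M⟯ | IsTransversalTo d f N} :=
  ⟨isDOpen_diffeomorphs, isDOpen_localDiffeomorphs, isDOpen_submersions, isDOpen_immersions,
    isDOpen_smoothEmbeddings, fun _ _ _ hN ↦ isDOpen_transversal hN⟩
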